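/- Let $n\ge 1$, let $M$ be a closed (compact, without boundary) connected smooth manifold of dimension $2n+1$, and let $\alpha$ be a contact form on $M$, i.e. a smooth $1$-form such that $\mu=\alpha\wedge(d\alpha)^n$ is a volume form. For a smooth family $\{X_t\}_{0\le t\le 1}$ of vector fields on $M$ that are divergence-free with respect to $\mu$ (each $\iota(X_t)\mu$ is closed), its flux is the de Rham cohomology class $$\mathrm{Flux}(\{X_t\})=\left[\int_0^1\iota(X_t)\mu\,dt\right]\in H^{2n}(M,\mathbb R),$$ and the flux of a smooth isotopy $\{\varphi_t\}_{0\le t\le 1}$, $\varphi_0=\mathrm{id}$, whose infinitesimal generator, determined by $\frac{d}{dt}\varphi_t=X_t\circ\varphi_t$, is such a family is the flux of that generator. The Reeb vector field $R_\alpha$ is the unique smooth vector field with $\mathcal L_{R_\alpha}\alpha=0$ and $\alpha(R_\alpha)=1$, and the Reeb flow is its flow. Then $R_\alpha$ is divergence-free with respect to $\mu$, and the flux of the Reeb flow vanishes: $\mathrm{Flux}(R_\alpha)=\left[\iota(R_\alpha)\mu\right]=0$ in $H^{2n}(M,\mathbb R)$. -/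

import Mathlib

open Set Topology MeasureTheory
open scoped Manifold ContDiff

noncomputable section

namespace VolumeFlux

/-! ### Exterior algebra of one real vector space -/

section Algebra

variable {V : Type*} [AddCommGroup V] [Module ℝ V] [TopologicalSpace V]

theorem continuous_domCoprod {k l : ℕ}
    (a : V [⋀^Fin k]→L[ℝ] ℝ) (b : V [⋀^Fin l]→L[ℝ] ℝ) :
    Continuous fun v : Fin k ⊕ Fin l → V =>
      LinearMap.mul' ℝ ℝ ((a.toAlternatingMap.domCoprod b.toAlternatingMap) v) := by
  have key : (fun v : Fin k ⊕ Fin l → V =>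
      LinearMap.mul' ℝ ℝ ((a.toAlternatingMap.domCoprod b.toAlternatingMap) v)) =
      fun v => ∑ σ : Equiv.Perm.ModSumCongr (Fin k) (Fin l), LinearMap.mul' ℝ ℝ
        (AlternatingMap.domCoprod.summand a.toAlternatingMap b.toAlternatingMap σ v) := by
    funext v
    rw [AlternatingMap.domCoprod_apply, sum_apply, map_sum]
  rw [key]
  refine continuous_finsetSum _ fun σ _ => ?_
  induction σ using Quotient.inductionOn' with
  | h σ =>
    have h2 : (fun v : Fin k ⊕ Fin l → V => LinearMap.mul' ℝ ℝ
        (AlternatingMap.domCoprod.summand a.toAlternatingMap b.toAlternatingMap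
          (Quotient.mk'' σ) v)) =
        fun v => ((Equiv.Perm.sign σ : ℤ) : ℝ) *
          (a (fun i => v (σ (Sum.inl i))) * b (fun i => v (σ (Sum.inr i)))) := by
      funext v
      rw [AlternatingMap.domCoprod.summand_mk'']
      rcases Int.units_eq_one_or (Equiv.Perm.sign σ) with h | h <;> simp [h]
    rw [h2]
    have ha : Continuous fun v : Fin k ⊕ Fin l → V => a (fun i => v (σ (Sum.inl i))) :=
      a.coe_continuous.comp (continuous_pi fun i => continuous_apply _)
    have hb : Continuous fun v : Fin k ⊕ Fin l → V => b (fun i => v (σ (Sum.inr i))) :=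
      b.coe_continuous.comp (continuous_pi fun i => continuous_apply _)
    exact continuous_const.mul (ha.mul hb)

/-- The wedge product `a ∧ b` of alternating forms of degrees `k` and `l`, as a form of degree
`m = k + l`, in the determinant normalization: the signed sum of
`a (v_{σ 1}, …, v_{σ k}) * b (v_{σ (k+1)}, …, v_{σ (k+l)})` over the `(k, l)`-shuffles `σ`. -/
def wedge {k l m : ℕ} (h : k + l = m)
    (a : V [⋀^Fin k]→L[ℝ] ℝ) (b : V [⋀^Fin l]→L[ℝ] ℝ) : V [⋀^Fin m]→L[ℝ] ℝ :=
  { ((LinearMap.mul' ℝ ℝ).compAlternatingMap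
      (a.toAlternatingMap.domCoprod b.toAlternatingMap)).domDomCongr
        (finSumFinEquiv.trans (finCongr h)) with
    cont := (continuous_domCoprod a b).comp (continuous_pi fun _ => continuous_apply _) }

/-- The powers `β^m = β ∧ ⋯ ∧ β` of a `2`-form. -/
def wedgePow (β : V [⋀^Fin 2]→L[ℝ] ℝ) : (m : ℕ) → V [⋀^Fin (2 * m)]→L[ℝ] ℝ
  | 0 => ContinuousAlternatingMap.constOfIsEmpty ℝ V (Fin 0) (1 : ℝ)
  | m + 1 => wedge (rfl : 2 * m + 2 = 2 * (m + 1)) (wedgePow β m) β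

/-- The interior product `ι(v) a`, that is, `a (v, ·, …, ·)`. -/
def interiorProd {k : ℕ} (v : V) (a : V [⋀^Fin (k + 1)]→L[ℝ] ℝ) : V [⋀^Fin k]→L[ℝ] ℝ :=
  { a.toAlternatingMap.curryLeft v with
    cont := a.coe_continuous.comp
      (continuous_pi fun i => Fin.cases continuous_const (fun j => continuous_apply j) i) }

end Algebra

/-! ### Differential forms, exterior derivative and de Rham cohomology -/

/-- The Euclidean space on which `d`-dimensional manifolds are modelled. -/
abbrev Model (d : ℕ) : Type := EuclideanSpace ℝ (Fin d)

section Forms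

variable {d : ℕ} {M : Type*} [TopologicalSpace M] [ChartedSpace (Model d) M]

/-- Fields of alternating `k`-forms on the tangent spaces of `M`, without any regularity. The
tangent space `TangentSpace (𝓡 d) x` is by definition the model space `Model d` (through the
preferred chart at `x`); it is written in this form to have the norm of `Model d` at hand. -/
def FormField (d : ℕ) (M : Type*) (k : ℕ) : Type _ := M → Model d [⋀^Fin k]→L[ℝ] ℝ

instance (d : ℕ) (M : Type*) (k : ℕ) : AddCommGroup (FormField d M k) :=
  inferInstanceAs (AddCommGroup (M → Model d [⋀^Fin k]→L[ℝ] ℝ))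

instance (d : ℕ) (M : Type*) (k : ℕ) : Module ℝ (FormField d M k) :=
  inferInstanceAs (Module ℝ (M → Model d [⋀^Fin k]→L[ℝ] ℝ))

variable (d M) in
/-- Vector fields on `M`, without any regularity. -/
abbrev VecField : Type _ := (x : M) → TangentSpace (𝓡 d) x

/-- The coordinate expression of `β` in the preferred chart at `x₀`: the pullback of `β` under the
inverse of this chart, relevant only on the target of the chart. -/
def inChart {k : ℕ} (β : FormField d M k) (x₀ : M) (y : Model d) : Model d [⋀^Fin k]→L[ℝ] ℝ :=
  (β ((extChartAt (𝓡 d) x₀).symm y)).compContinuousLinearMap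
    (mfderiv 𝓘(ℝ, Model d) (𝓡 d) (extChartAt (𝓡 d) x₀).symm y : Model d →L[ℝ] Model d)

/-- `β` is a smooth differential form: all its coordinate expressions are smooth. -/
def IsSmoothForm {k : ℕ} (β : FormField d M k) : Prop :=
  ∀ x₀ : M, ContDiffOn ℝ ∞ (inChart β x₀) (extChartAt (𝓡 d) x₀).target

/-- The exterior derivative, computed at each point `x` in the preferred chart at `x`. -/
def extD {k : ℕ} (β : FormField d M k) : FormField d M (k + 1) := fun x =>
  (extDeriv (inChart β x) (extChartAt (𝓡 d) x x)).compContinuousLinearMap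
    (mfderiv (𝓡 d) 𝓘(ℝ, Model d) (extChartAt (𝓡 d) x) x : Model d →L[ℝ] Model d)

theorem inChart_add {k : ℕ} (β η : FormField d M k) (x₀ : M) :
    inChart (β + η) x₀ = inChart β x₀ + inChart η x₀ := rfl

theorem inChart_smul {k : ℕ} (c : ℝ) (β : FormField d M k) (x₀ : M) :
    inChart (c • β) x₀ = c • inChart β x₀ := rfl

theorem inChart_zero {k : ℕ} (x₀ : M) : inChart (0 : FormField d M k) x₀ = 0 := rfl

theorem IsSmoothForm.add {k : ℕ} {β η : FormField d M k} (hβ : IsSmoothForm β)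
    (hη : IsSmoothForm η) : IsSmoothForm (β + η) := fun x₀ => by
  rw [inChart_add]; exact (hβ x₀).add (hη x₀)

theorem IsSmoothForm.smul {k : ℕ} (c : ℝ) {β : FormField d M k} (hβ : IsSmoothForm β) :
    IsSmoothForm (c • β) := fun x₀ => by
  rw [inChart_smul]; exact (hβ x₀).const_smul c

theorem isSmoothForm_zero {k : ℕ} : IsSmoothForm (0 : FormField d M k) := fun x₀ => by
  rw [inChart_zero]; exact contDiffOn_const

theorem IsSmoothForm.differentiableAt {k : ℕ} {β : FormField d M k} (hβ : IsSmoothForm β)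
    (x : M) : DifferentiableAt ℝ (inChart β x) (extChartAt (𝓡 d) x x) :=
  ((hβ x).contDiffAt (extChartAt_target_mem_nhds x)).differentiableAt (by simp)

theorem extD_add {k : ℕ} {β η : FormField d M k} (hβ : IsSmoothForm β) (hη : IsSmoothForm η) :
    extD (β + η) = extD β + extD η := by
  funext x
  simp only [extD, inChart_add]
  rw [extDeriv_add (hβ.differentiableAt x) (hη.differentiableAt x)]
  rfl

theorem extD_smul {k : ℕ} (c : ℝ) (β : FormField d M k) : extD (c • β) = c • extD β := by
  funext x
  simp only [extD, inChart_smul]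
  rw [extDeriv_smul]
  rfl

theorem extD_zero {k : ℕ} : extD (0 : FormField d M k) = 0 := by
  have h := extD_smul (0 : ℝ) (0 : FormField d M k)
  rwa [zero_smul, zero_smul] at h

variable (d M) in
/-- The space of closed smooth `k`-forms. -/
def closedForms (k : ℕ) : Submodule ℝ (FormField d M k) where
  carrier := {β | IsSmoothForm β ∧ extD β = 0}
  zero_mem' := ⟨isSmoothForm_zero, extD_zero⟩
  add_mem' := fun hβ hη => ⟨hβ.1.add hη.1, by rw [extD_add hβ.1 hη.1, hβ.2, hη.2, add_zero]⟩
  smul_mem' := fun c _ hβ => ⟨hβ.1.smul c, by rw [extD_smul, hβ.2, smul_zero]⟩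

variable (d M) in
/-- The space of exact `k`-forms: exterior derivatives of smooth `(k - 1)`-forms; only `0` is
exact in degree `0`. -/
def exactForms : (k : ℕ) → Submodule ℝ (FormField d M k)
  | 0 => ⊥
  | k + 1 =>
    { carrier := {β | ∃ η : FormField d M k, IsSmoothForm η ∧ extD η = β}
      zero_mem' := ⟨0, isSmoothForm_zero, extD_zero⟩
      add_mem' := by
        rintro _ _ ⟨η, hη, rfl⟩ ⟨θ, hθ, rfl⟩
        exact ⟨η + θ, hη.add hθ, extD_add hη hθ⟩
      smul_mem' := by
        rintro c _ ⟨η, hη, rfl⟩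
        exact ⟨c • η, hη.smul c, extD_smul c η⟩ }

variable (d M) in
/-- The de Rham cohomology `H^k(M, ℝ)`: closed forms modulo exact forms. -/
abbrev DeRham (k : ℕ) : Type _ :=
  closedForms d M k ⧸ (exactForms d M k).comap (closedForms d M k).subtype

/-- The cohomology class of a closed form. -/
def deRhamClass {k : ℕ} (β : closedForms d M k) : DeRham d M k := Submodule.Quotient.mk β

/-! ### Vector fields, isotopies and the flux -/

/-- The Lie derivative of a `1`-form `α` along the vector field `X`. With `a` and `V` the
expressions of `α` and `X` in the preferred chart at `x`, it is
`(L_X α)_x (v) = (∂_V a) (v) + a (∂_v V)`, i.e. `(L_X α)_j = X^i ∂_i α_j + α_i ∂_j X^i`. -/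
def lieD (X : VecField d M) (α : FormField d M 1) : FormField d M 1 := fun x =>
  let a : Model d → Model d [⋀^Fin 1]→L[ℝ] ℝ := inChart α x
  let V : Model d → Model d :=
    VectorField.mpullback 𝓘(ℝ, Model d) (𝓡 d) (extChartAt (𝓡 d) x).symm X
  let p : Model d := extChartAt (𝓡 d) x x
  (fderiv ℝ a p (V p) + (a p).compContinuousLinearMap (fderiv ℝ V p)).compContinuousLinearMap
    (mfderiv (𝓡 d) 𝓘(ℝ, Model d) (extChartAt (𝓡 d) x) x : Model d →L[ℝ] Model d)

variable [IsManifold (𝓡 d) ∞ M]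

/-- `X` is a smooth vector field. -/
def IsSmoothField (X : VecField d M) : Prop :=
  ContMDiff (𝓡 d) (𝓡 d).tangent ∞ fun x => (⟨x, X x⟩ : TangentBundle (𝓡 d) M)

/-- `{X_t}_{0 ≤ t ≤ 1}` is a smooth family of vector fields. -/
def IsSmoothFamily (X : ℝ → VecField d M) : Prop :=
  ContMDiffOn (𝓘(ℝ, ℝ).prod (𝓡 d)) (𝓡 d).tangent ∞
    (fun p : ℝ × M => (⟨p.2, X p.1 p.2⟩ : TangentBundle (𝓡 d) M)) (Icc 0 1 ×ˢ univ)

/-- The form `∫₀¹ ι(X_t) μ dt`, integrated pointwise in the finite-dimensional space of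
alternating forms on the tangent space (which is by definition the model space). -/
def fluxForm {k : ℕ} (μ : FormField d M (k + 1)) (X : ℝ → VecField d M) : FormField d M k :=
  fun x => ∫ t in (0 : ℝ)..1, interiorProd (X t x : Model d) (μ x)

/-- `X` is divergence-free with respect to the volume form `μ`: the form `ι(X) μ` is closed. -/
def IsDivergenceFree {k : ℕ} (μ : FormField d M (k + 1)) (X : VecField d M) : Prop :=
  (fun x => interiorProd (X x : Model d) (μ x) : FormField d M k) ∈ closedForms d M k

/-- The smooth family `{X_t}_{0 ≤ t ≤ 1}` of divergence-free vector fields has flux `c`: the form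
`∫₀¹ ι(X_t) μ dt` is closed and represents the class `c`. -/
def HasFlux {k : ℕ} (μ : FormField d M (k + 1)) (X : ℝ → VecField d M) (c : DeRham d M k) :
    Prop :=
  IsSmoothFamily X ∧ (∀ t ∈ Icc (0 : ℝ) 1, IsDivergenceFree μ (X t)) ∧
    ∃ h : fluxForm μ X ∈ closedForms d M k, deRhamClass ⟨fluxForm μ X, h⟩ = c

end Forms

section Isotopies

variable {d : ℕ} {M : Type*} [TopologicalSpace M] [ChartedSpace (Model d) M]
  [IsManifold (𝓡 d) ∞ M]

variable (d M) in
/-- A smooth isotopy `{φ_t}_{0 ≤ t ≤ 1}` of diffeomorphisms of `M` with `φ_0 = id`; the values at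
times outside `[0, 1]` are irrelevant. -/
structure Isotopy where
  /-- The diffeomorphism `φ_t`. -/
  diffeo : ℝ → Diffeomorph (𝓡 d) (𝓡 d) M M ∞
  /-- Joint smoothness on `[0, 1] × M`. -/
  smooth : ContMDiffOn (𝓘(ℝ, ℝ).prod (𝓡 d)) (𝓡 d) ∞
    (fun p : ℝ × M => diffeo p.1 p.2) (Icc 0 1 ×ˢ univ)
  /-- The isotopy starts at the identity. -/
  map_zero : ∀ x, diffeo 0 x = x

/-- `{X_t}` is the infinitesimal generator of `{φ_t}`, that is, `d/dt φ_t = X_t ∘ φ_t` for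
`0 ≤ t ≤ 1` (with one-sided derivatives at the ends). -/
def Isotopy.IsGeneratedBy (φ : Isotopy d M) (X : ℝ → VecField d M) : Prop :=
  ∀ t ∈ Icc (0 : ℝ) 1, ∀ x : M,
    HasMFDerivWithinAt 𝓘(ℝ, ℝ) (𝓡 d) (fun s : ℝ => φ.diffeo s x) (Icc 0 1) t
      ((ContinuousLinearMap.id ℝ ℝ).smulRight (X t (φ.diffeo t x)))

/-- The isotopy `φ` has flux `c` with respect to `μ`: its infinitesimal generator, which is
uniquely determined on `[0, 1]`, does. -/
def Isotopy.HasFlux {k : ℕ} (φ : Isotopy d M) (μ : FormField d M (k + 1)) (c : DeRham d M k) :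
    Prop :=
  ∃ X : ℝ → VecField d M, φ.IsGeneratedBy X ∧ VolumeFlux.HasFlux μ X c

end Isotopies

/-! ### Contact forms -/

section Contact

variable {n : ℕ} {M : Type*} [TopologicalSpace M] [ChartedSpace (Model (2 * n + 1)) M]

/-- The form `α ∧ (dα)^n` of top degree induced by a `1`-form on a `(2n+1)`-manifold. -/
def contactVolume (α : FormField (2 * n + 1) M 1) : FormField (2 * n + 1) M (2 * n + 1) :=
  fun x => wedge (Nat.add_comm 1 (2 * n)) (α x) (wedgePow (extD α x) n)

/-- `α` is a contact form: a smooth `1`-form such that `α ∧ (dα)^n` vanishes nowhere. -/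
def IsContactForm (α : FormField (2 * n + 1) M 1) : Prop :=
  IsSmoothForm α ∧ ∀ x, contactVolume α x ≠ 0

/-- `R` is the Reeb vector field of the contact form `α`: the smooth vector field that is strictly
contact (`L_R α = 0`) and has contact Hamiltonian `α(R) = 1`. -/
def IsReebField [IsManifold (𝓡 (2 * n + 1)) ∞ M] (α : FormField (2 * n + 1) M 1)
    (R : VecField (2 * n + 1) M) : Prop :=
  IsSmoothField R ∧ lieD R α = 0 ∧ ∀ x, α x (fun _ => R x) = 1

end Contact

end VolumeFlux

end

/-! Write `μ = α ∧ (dα)^n`. Since `α(R) = 1` is constant, Cartan's formula turns `L_R α = 0` into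
`ι(R) dα = 0` (`annihilates_extD`). Contraction with `R` therefore passes through every factor `dα`,
and `ι(R) μ = α(R) (dα)^n = (dα)^n` (`interiorProd_wedge`, `interiorProd_contactVolume`). This form
is closed because `d² = 0` (`extDPow_mem_closedForms`), and for `n = m + 1` it is exact, being
`d((dα)^m ∧ α)` (`extD_extDPowWedge`). The Reeb field does not depend on time, so its flux form is
`ι(R) μ` itself and its class is zero.

Most of the work is the Leibniz rule for `wedge` (`extDeriv_wedge`) and the fact that `extD`,
defined pointwise in the preferred chart, is computed by any chart (`inChart_extD`). For the former,
sums over shuffles are replaced by sums over all permutations, at the cost of a factor `k! l!`. -/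

noncomputable section

namespace VolumeFlux

/-! ### Signed sums over permutations -/

section Permutations

/-- The pair `(i, τ)` gives the permutation sending `0` to `i` and `j + 1` to `i.succAbove (τ j)`.
Its value at `0` recovers `i`, hence injectivity; the cardinalities agree because `(n + 1) * n! = (n
+ 1)!`. -/
theorem perm_cons_bijective (n : ℕ) : Function.Bijective
    fun p : Fin (n + 1) × Equiv.Perm (Fin n) =>
      p.1.cycleRange.symm * Equiv.Perm.decomposeFin.symm (0, p.2) := by
  rw [Fintype.bijective_iff_injective_and_card]
  constructor
  · rintro ⟨i, τ⟩ ⟨i', τ'⟩ h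
    have h0 := Equiv.congr_fun h 0
    simp at h0
    subst h0
    simpa using h
  · simp [Fintype.card_perm, Nat.factorial_succ]

/-- Expansion of a signed sum over the permutations of `Fin (n + 1)` by the image of `0`. -/
theorem sum_perm_succ {n : ℕ} (f : (Fin (n + 1) → Fin (n + 1)) → ℝ) :
    ∑ σ : Equiv.Perm (Fin (n + 1)), ((Equiv.Perm.sign σ : ℤ) : ℝ) * f σ =
      ∑ i : Fin (n + 1), (-1) ^ (i : ℕ) * ∑ τ : Equiv.Perm (Fin n),
        ((Equiv.Perm.sign τ : ℤ) : ℝ) * f (Fin.cons i fun j => i.succAbove (τ j)) := by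
  rw [← (perm_cons_bijective n).sum_comp, Fintype.sum_prod_type]
  refine Finset.sum_congr rfl fun i _ => ?_
  rw [Finset.mul_sum]
  refine Finset.sum_congr rfl fun τ _ => ?_
  have h : ⇑(i.cycleRange.symm * Equiv.Perm.decomposeFin.symm (0, τ)) =
      Fin.cons i fun j => i.succAbove (τ j) := by
    funext j
    refine Fin.cases ?_ (fun j => ?_) j <;> simp
  rw [h, map_mul]
  simp [Fin.sign_cycleRange, mul_assoc]

/-- A signed sum over permutations changes by the sign under a right translation. -/
theorem sum_perm_comp {n : ℕ} (ρ : Equiv.Perm (Fin n)) (f : (Fin n → Fin n) → ℝ) :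
    ∑ σ : Equiv.Perm (Fin n), ((Equiv.Perm.sign σ : ℤ) : ℝ) * f (σ ∘ ρ) =
      ((Equiv.Perm.sign ρ : ℤ) : ℝ) *
        ∑ σ : Equiv.Perm (Fin n), ((Equiv.Perm.sign σ : ℤ) : ℝ) * f σ := by
  rw [← Equiv.sum_comp (Equiv.mulRight ρ) (fun σ => ((Equiv.Perm.sign σ : ℤ) : ℝ) * f σ),
    Finset.mul_sum]
  refine Finset.sum_congr rfl fun σ _ => ?_
  rcases Int.units_eq_one_or (Equiv.Perm.sign ρ) with h | h <;>
    simp [h, Equiv.Perm.coe_mul]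

/-- Bringing slot `p` to the front is a right translation by a cycle of sign `(-1)^p`. -/
theorem sum_perm_succAbove {n : ℕ} (p : Fin (n + 1)) (f : (Fin (n + 1) → Fin (n + 1)) → ℝ) :
    ∑ σ : Equiv.Perm (Fin (n + 1)), ((Equiv.Perm.sign σ : ℤ) : ℝ) *
        f (Fin.cons (σ p) fun j => σ (p.succAbove j)) =
      (-1) ^ (p : ℕ) * ∑ σ : Equiv.Perm (Fin (n + 1)), ((Equiv.Perm.sign σ : ℤ) : ℝ) * f σ := by
  have h := sum_perm_comp p.cycleRange.symm f
  rw [Equiv.Perm.sign_symm, Fin.sign_cycleRange] at h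
  push_cast at h
  rw [← h]
  refine Finset.sum_congr rfl fun σ _ => ?_
  congr 2
  funext j
  refine Fin.cases ?_ (fun j => ?_) j <;> simp

end Permutations

/-! ### Algebra of the wedge product and of contraction -/

section Algebra

variable {V : Type*} [AddCommGroup V] [Module ℝ V] [TopologicalSpace V]

/-- Each shuffle represents a coset of `S_k × S_l`, on which the signed summand is constant, so the
sum over all of `S_m` counts it `k! l!` times. Identities between wedges are proved below by
multiplying by this nonzero factor. -/
theorem wedge_apply {k l m : ℕ} (h : k + l = m)
    (a : V [⋀^Fin k]→L[ℝ] ℝ) (b : V [⋀^Fin l]→L[ℝ] ℝ) (v : Fin m → V) :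
    ((k.factorial : ℝ) * l.factorial) * wedge h a b v =
      ∑ σ : Equiv.Perm (Fin m), ((Equiv.Perm.sign σ : ℤ) : ℝ) *
        (a (fun i => v (σ (Fin.cast h (Fin.castAdd l i)))) *
          b (fun i => v (σ (Fin.cast h (Fin.natAdd k i))))) := by
  subst h
  have key := MultilinearMap.domCoprod_alternization_eq a.toAlternatingMap b.toAlternatingMap
  have key2 := congrArg (fun f => LinearMap.mul' ℝ ℝ (f (v ∘ finSumFinEquiv))) key
  simp only [Fintype.card_fin, MultilinearMap.alternatization_apply, map_sum] at key2
  have hw : wedge rfl a b v =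
      LinearMap.mul' ℝ ℝ (a.toAlternatingMap.domCoprod b.toAlternatingMap
        (v ∘ finSumFinEquiv)) := rfl
  rw [hw]
  have h3 : LinearMap.mul' ℝ ℝ (((k.factorial * l.factorial) •
      a.toAlternatingMap.domCoprod b.toAlternatingMap) (v ∘ finSumFinEquiv)) =
      ((k.factorial : ℝ) * l.factorial) *
      LinearMap.mul' ℝ ℝ (a.toAlternatingMap.domCoprod b.toAlternatingMap
        (v ∘ finSumFinEquiv)) := by
    rw [AlternatingMap.smul_apply, map_nsmul, nsmul_eq_mul]
    push_cast
    rfl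
  rw [← h3, ← key2, ← (finSumFinEquiv.permCongr).sum_comp]
  refine Finset.sum_congr rfl fun σ _ => ?_
  rw [Equiv.Perm.sign_permCongr]
  rcases Int.units_eq_one_or (Equiv.Perm.sign σ) with h | h <;>
    simp [h, MultilinearMap.domCoprod_apply, Equiv.permCongr_apply,
      -finSumFinEquiv_apply_left, -finSumFinEquiv_apply_right]

theorem factorial_mul_ne_zero (k l : ℕ) : ((k.factorial : ℝ) * l.factorial) ≠ 0 := by
  positivity

theorem wedge_add_left {k l m : ℕ} (h : k + l = m)
    (a a' : V [⋀^Fin k]→L[ℝ] ℝ) (b : V [⋀^Fin l]→L[ℝ] ℝ) [IsTopologicalAddGroup V] :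
    wedge h (a + a') b = wedge h a b + wedge h a' b := by
  ext v
  apply mul_left_cancel₀ (factorial_mul_ne_zero k l)
  rw [ContinuousAlternatingMap.add_apply, mul_add]
  simp only [wedge_apply, ← Finset.sum_add_distrib, ContinuousAlternatingMap.add_apply]
  exact Finset.sum_congr rfl fun σ _ => by ring

theorem wedge_add_right {k l m : ℕ} (h : k + l = m)
    (a : V [⋀^Fin k]→L[ℝ] ℝ) (b b' : V [⋀^Fin l]→L[ℝ] ℝ) [IsTopologicalAddGroup V] :
    wedge h a (b + b') = wedge h a b + wedge h a b' := by
  ext v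
  apply mul_left_cancel₀ (factorial_mul_ne_zero k l)
  rw [ContinuousAlternatingMap.add_apply, mul_add]
  simp only [wedge_apply, ← Finset.sum_add_distrib, ContinuousAlternatingMap.add_apply]
  exact Finset.sum_congr rfl fun σ _ => by ring

theorem wedge_smul_left {k l m : ℕ} (h : k + l = m) (c : ℝ)
    (a : V [⋀^Fin k]→L[ℝ] ℝ) (b : V [⋀^Fin l]→L[ℝ] ℝ) :
    wedge h (c • a) b = c • wedge h a b := by
  ext v
  apply mul_left_cancel₀ (factorial_mul_ne_zero k l)
  rw [ContinuousAlternatingMap.smul_apply, smul_eq_mul, mul_left_comm]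
  simp only [wedge_apply, Finset.mul_sum, ContinuousAlternatingMap.smul_apply, smul_eq_mul]
  exact Finset.sum_congr rfl fun σ _ => by ring

theorem wedge_smul_right {k l m : ℕ} (h : k + l = m) (c : ℝ)
    (a : V [⋀^Fin k]→L[ℝ] ℝ) (b : V [⋀^Fin l]→L[ℝ] ℝ) :
    wedge h a (c • b) = c • wedge h a b := by
  ext v
  apply mul_left_cancel₀ (factorial_mul_ne_zero k l)
  rw [ContinuousAlternatingMap.smul_apply, smul_eq_mul, mul_left_comm]
  simp only [wedge_apply, Finset.mul_sum, ContinuousAlternatingMap.smul_apply, smul_eq_mul]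
  exact Finset.sum_congr rfl fun σ _ => by ring

theorem wedge_zero_left {k l m : ℕ} (h : k + l = m) (b : V [⋀^Fin l]→L[ℝ] ℝ) :
    wedge h (0 : V [⋀^Fin k]→L[ℝ] ℝ) b = 0 := by
  simpa using wedge_smul_left h 0 (0 : V [⋀^Fin k]→L[ℝ] ℝ) b

theorem wedge_zero_right {k l m : ℕ} (h : k + l = m) (a : V [⋀^Fin k]→L[ℝ] ℝ) :
    wedge h a (0 : V [⋀^Fin l]→L[ℝ] ℝ) = 0 := by
  simpa using wedge_smul_right h 0 a (0 : V [⋀^Fin l]→L[ℝ] ℝ)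

section Pullback

variable {W : Type*} [AddCommGroup W] [Module ℝ W] [TopologicalSpace W]

theorem wedge_compContinuousLinearMap {k l m : ℕ} (h : k + l = m)
    (a : V [⋀^Fin k]→L[ℝ] ℝ) (b : V [⋀^Fin l]→L[ℝ] ℝ) (f : W →L[ℝ] V) :
    (wedge h a b).compContinuousLinearMap f =
      wedge h (a.compContinuousLinearMap f) (b.compContinuousLinearMap f) := by
  ext v
  apply mul_left_cancel₀ (factorial_mul_ne_zero k l)
  rw [ContinuousAlternatingMap.compContinuousLinearMap_apply, wedge_apply, wedge_apply]
  rfl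

theorem wedgePow_compContinuousLinearMap (β : V [⋀^Fin 2]→L[ℝ] ℝ) (f : W →L[ℝ] V) (m : ℕ) :
    (wedgePow β m).compContinuousLinearMap f = wedgePow (β.compContinuousLinearMap f) m := by
  induction m with
  | zero => rfl
  | succ m ih => rw [wedgePow, wedge_compContinuousLinearMap, ih, wedgePow]

end Pullback

/-- The form `b` vanishes as soon as one of its arguments is `v`. -/
def Annihilates {k : ℕ} (v : V) (b : V [⋀^Fin k]→L[ℝ] ℝ) : Prop :=
  ∀ (w : Fin k → V) (i : Fin k), w i = v → b w = 0

/-- In each term of the permutation sum the argument `v` lands in a slot of `a` or in a slot of `b`.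
-/
theorem Annihilates.wedge {k l m : ℕ} (h : k + l = m) {v : V} {a : V [⋀^Fin k]→L[ℝ] ℝ}
    {b : V [⋀^Fin l]→L[ℝ] ℝ} (ha : Annihilates v a) (hb : Annihilates v b) :
    Annihilates v (wedge h a b) := by
  subst h
  intro w i hi
  apply mul_left_cancel₀ (factorial_mul_ne_zero k l)
  rw [wedge_apply, mul_zero]
  refine Finset.sum_eq_zero fun σ _ => ?_
  obtain ⟨p, rfl⟩ := σ.surjective i
  induction p using Fin.addCases with
  | left p => rw [ha _ p hi]; simp
  | right p => rw [hb _ p hi]; simp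

theorem Annihilates.wedgePow {v : V} {β : V [⋀^Fin 2]→L[ℝ] ℝ} (hβ : Annihilates v β) (m : ℕ) :
    Annihilates v (wedgePow β m) := by
  induction m with
  | zero => exact fun _ i => i.elim0
  | succ m ih => exact ih.wedge _ hβ

theorem annihilates_two {v : V} {β : V [⋀^Fin 2]→L[ℝ] ℝ} (hβ : ∀ w, β ![v, w] = 0) :
    Annihilates v β := by
  intro w i hi
  fin_cases i
  · have : w = ![v, w 1] := by
      funext j; fin_cases j <;> simp_all
    rw [this, hβ]
  · have : w ∘ Equiv.swap 0 1 = ![v, w 0] := by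
      funext j; fin_cases j <;> simp_all
    have h2 := β.toAlternatingMap.map_swap w (show (0 : Fin 2) ≠ 1 by decide)
    have h3 : β (w ∘ Equiv.swap 0 1) = - β w := h2
    rw [this, hβ] at h3
    linarith

/-- If `a v = 1` and `ι(v) b = 0`, then `ι(v) (a ∧ b) = b`. -/
theorem interiorProd_wedge {k : ℕ} (h : 1 + k = k + 1) {v : V} {a : V [⋀^Fin 1]→L[ℝ] ℝ}
    {b : V [⋀^Fin k]→L[ℝ] ℝ} (ha : a (fun _ => v) = 1) (hb : Annihilates v b) :
    interiorProd v (wedge h a b) = b := by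
  ext w
  change wedge h a b (Fin.cons v w) = b w
  apply mul_left_cancel₀ (factorial_mul_ne_zero 1 k)
  -- Split by the index of the vector fed to `a`. Index `0` feeds it `v`, and the remaining sum is
  -- `k!` copies of `b w`; any other index leaves `v` to `b`, which kills the term.
  rw [wedge_apply, sum_perm_succ (fun σ => a (fun i => (Fin.cons v w : Fin (k + 1) → V)
      (σ (Fin.cast h (Fin.castAdd k i)))) *
      b (fun i => (Fin.cons v w : Fin (k + 1) → V) (σ (Fin.cast h (Fin.natAdd 1 i))))),
    Fin.sum_univ_succ, Finset.sum_eq_zero (s := (Finset.univ : Finset (Fin k))), add_zero]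
  · have h0 : ∀ i : Fin 1, Fin.cast h (Fin.castAdd k i) = 0 := fun i => by
      ext; simp
    have h1 : ∀ i : Fin k, Fin.cast h (Fin.natAdd 1 i) = i.succ := fun i => by
      ext; simp
    simp only [h0, h1, Fin.cons_zero, Fin.cons_succ, ha, Fin.succAbove_zero, one_mul]
    have h2 : ∀ τ : Equiv.Perm (Fin k), ((Equiv.Perm.sign τ : ℤ) : ℝ) *
        b (fun i => w (τ i)) = b w := fun τ => by
      have h3 : b (fun i => w (τ i)) = Equiv.Perm.sign τ • b w :=
        b.toAlternatingMap.map_perm w τ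
      rw [h3]
      rcases Int.units_eq_one_or (Equiv.Perm.sign τ) with h | h <;> simp [h]
    simp [h2, Fintype.card_perm]
  · intro i _
    refine mul_eq_zero_of_right _ (Finset.sum_eq_zero fun τ _ => ?_)
    obtain ⟨p, hp⟩ := Fin.exists_succAbove_eq (Fin.succ_ne_zero i).symm
    rw [hb _ (τ.symm p), mul_zero, mul_zero]
    have h1 : Fin.cast h (Fin.natAdd 1 (τ.symm p)) = (τ.symm p).succ := by
      ext; simp [add_comm]
    rw [h1, Fin.cons_succ, Equiv.apply_symm_apply, hp, Fin.cons_zero]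

end Algebra

/-! ### Alternatization of a wedge product -/

section Alternatization

variable {V : Type*} [NormedAddCommGroup V] [NormedSpace ℝ V]

/-- The continuous bilinear map underlying the wedge product. -/
def wedgeCLM {k l m : ℕ} (h : k + l = m) :
    (V [⋀^Fin k]→L[ℝ] ℝ) →L[ℝ] (V [⋀^Fin l]→L[ℝ] ℝ) →L[ℝ] (V [⋀^Fin m]→L[ℝ] ℝ) :=
  LinearMap.mkContinuous₂
    (LinearMap.mk₂ ℝ (wedge h) (fun a a' b => wedge_add_left h a a' b) (wedge_smul_left h) (fun a b b' => wedge_add_right h a b b')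
      (fun c a b => wedge_smul_right h c a b))
    -- There are `m!` permutations, each contributing at most `‖a‖ * ‖b‖ * ∏ i, ‖v i‖`; the factor
    -- `k! l! ≥ 1` is dropped.
    (m.factorial) (by
      intro a b
      refine ContinuousAlternatingMap.opNorm_le_bound _ (by positivity) fun v => ?_
      have h1 : ‖wedge h a b v‖ ≤ ‖((k.factorial : ℝ) * l.factorial) * wedge h a b v‖ := by
        rw [norm_mul]
        refine le_mul_of_one_le_left (norm_nonneg _) ?_
        rw [Real.norm_of_nonneg (by positivity)]
        exact_mod_cast Nat.mul_pos k.factorial_pos l.factorial_pos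
      refine h1.trans ?_
      rw [wedge_apply]
      refine (norm_sum_le _ _).trans ?_
      have h2 : ∀ σ ∈ (Finset.univ : Finset (Equiv.Perm (Fin m))),
          ‖((Equiv.Perm.sign σ : ℤ) : ℝ) *
            (a (fun i => v (σ (Fin.cast h (Fin.castAdd l i)))) *
              b (fun i => v (σ (Fin.cast h (Fin.natAdd k i)))))‖ ≤
            ‖a‖ * ‖b‖ * ∏ i, ‖v i‖ := by
        intro σ _
        have hs : ‖((Equiv.Perm.sign σ : ℤ) : ℝ)‖ = 1 := by
          rcases Int.units_eq_one_or (Equiv.Perm.sign σ) with h | h <;> simp [h]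
        rw [norm_mul, hs, one_mul, norm_mul]
        have hp : ∏ i, ‖v i‖ = (∏ i, ‖v (σ (Fin.cast h (Fin.castAdd l i)))‖) *
            ∏ i, ‖v (σ (Fin.cast h (Fin.natAdd k i)))‖ := by
          subst h
          rw [← Equiv.prod_comp σ, Fin.prod_univ_add]
          rfl
        calc _ ≤ (‖a‖ * ∏ i, ‖v (σ (Fin.cast h (Fin.castAdd l i)))‖) *
              (‖b‖ * ∏ i, ‖v (σ (Fin.cast h (Fin.natAdd k i)))‖) :=
              mul_le_mul (a.le_opNorm _) (b.le_opNorm _) (norm_nonneg _) (by positivity)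
          _ = _ := by rw [hp]; ring
      refine (Finset.sum_le_sum h2).trans (le_of_eq ?_)
      simp [Fintype.card_perm]
      ring)

theorem wedgeCLM_apply {k l m : ℕ} (h : k + l = m)
    (a : V [⋀^Fin k]→L[ℝ] ℝ) (b : V [⋀^Fin l]→L[ℝ] ℝ) : wedgeCLM h a b = wedge h a b := rfl

theorem alternatizeUncurryFin_apply' {k : ℕ} (L : V →L[ℝ] V [⋀^Fin k]→L[ℝ] ℝ)
    (v : Fin (k + 1) → V) : ContinuousAlternatingMap.alternatizeUncurryFin L v =
      ∑ i : Fin (k + 1), (-1 : ℝ) ^ (i : ℕ) * L (v i) fun j => v (i.succAbove j) := by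
  rw [ContinuousAlternatingMap.alternatizeUncurryFin_apply]
  refine Finset.sum_congr rfl fun i _ => ?_
  rw [zsmul_eq_mul]
  push_cast
  rfl

/-- Up to factorials both sides are the same signed sum `S` over `S_(m+1)`, with the differentiating
vector in slot `0`. On the right that vector sits in slot `k + j`; moving it to the front costs
`(-1)^(k+j)`, and the alternatization of `L` already carries `(-1)^j`. The `l + 1` values of `j`
account for `(l + 1)! = (l + 1) * l!`. -/
theorem alternatize_wedge_right {k l m : ℕ} (h : k + l = m) (h' : k + (l + 1) = m + 1)
    (c : V [⋀^Fin k]→L[ℝ] ℝ) (L : V →L[ℝ] V [⋀^Fin l]→L[ℝ] ℝ) :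
    ContinuousAlternatingMap.alternatizeUncurryFin ((wedgeCLM h c).comp L) =
      (-1 : ℝ) ^ k • wedge h' c (ContinuousAlternatingMap.alternatizeUncurryFin L) := by
  ext v
  set F : (Fin (m + 1) → Fin (m + 1)) → ℝ := fun σ =>
    c (fun i => v (σ (Fin.succ (Fin.cast h (Fin.castAdd l i))))) *
      L (v (σ 0)) (fun i => v (σ (Fin.succ (Fin.cast h (Fin.natAdd k i))))) with hF
  set S : ℝ := ∑ σ : Equiv.Perm (Fin (m + 1)), ((Equiv.Perm.sign σ : ℤ) : ℝ) * F σ with hS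
  have h1 : ((k.factorial : ℝ) * l.factorial) *
      ContinuousAlternatingMap.alternatizeUncurryFin ((wedgeCLM h c).comp L) v = S := by
    rw [alternatizeUncurryFin_apply', hS, sum_perm_succ, Finset.mul_sum]
    refine Finset.sum_congr rfl fun i _ => ?_
    rw [mul_left_comm, ContinuousLinearMap.comp_apply, wedgeCLM_apply, wedge_apply]
    simp [hF]
  have h2 : ((k.factorial : ℝ) * (l + 1).factorial) *
      wedge h' c (ContinuousAlternatingMap.alternatizeUncurryFin L) v =
        (-1) ^ k * ((l + 1) * S) := by
    rw [wedge_apply]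
    simp only [alternatizeUncurryFin_apply', Finset.mul_sum]
    rw [Finset.sum_comm]
    have h3 : ∀ j : Fin (l + 1), ∑ σ : Equiv.Perm (Fin (m + 1)),
        ((Equiv.Perm.sign σ : ℤ) : ℝ) *
          (c (fun i => v (σ (Fin.cast h' (Fin.castAdd (l + 1) i)))) * ((-1) ^ (j : ℕ) *
            L (v (σ (Fin.cast h' (Fin.natAdd k j))))
              fun i => v (σ (Fin.cast h' (Fin.natAdd k (j.succAbove i)))))) =
        (-1) ^ k * S := by
      intro j
      have hl : ∀ i, Fin.cast h' (Fin.castAdd (l + 1) i) =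
          (Fin.cast h' (Fin.natAdd k j)).succAbove (Fin.cast h (Fin.castAdd l i)) := by
        intro i
        ext
        simp only [Fin.succAbove, Fin.lt_def, Fin.val_cast, Fin.val_castAdd, Fin.val_natAdd,
          Fin.val_castSucc]
        split_ifs
        · simp
        · simp; omega
      have hr : ∀ i, Fin.cast h' (Fin.natAdd k (j.succAbove i)) =
          (Fin.cast h' (Fin.natAdd k j)).succAbove (Fin.cast h (Fin.natAdd k i)) := by
        intro i
        ext
        simp only [Fin.succAbove, Fin.lt_def, Fin.val_cast, Fin.val_natAdd, Fin.val_castSucc]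
        split_ifs <;> simp <;> omega
      have h4 := sum_perm_succAbove (Fin.cast h' (Fin.natAdd k j)) F
      rw [← hS, Fin.val_cast, Fin.val_natAdd, pow_add] at h4
      have h5 : (-1 : ℝ) ^ (j : ℕ) * (-1) ^ (j : ℕ) = 1 := by
        rw [← mul_pow]; simp
      rw [show (-1 : ℝ) ^ k * S = (-1) ^ (j : ℕ) * ((-1) ^ k * (-1) ^ (j : ℕ) * S) by
        linear_combination (-(-1 : ℝ) ^ k * S) * h5, ← h4, Finset.mul_sum]
      refine Finset.sum_congr rfl fun σ _ => ?_
      simp only [hF, Fin.cons_zero, Fin.cons_succ, hl, hr]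
      ring
    rw [Finset.sum_congr rfl fun j _ => h3 j]
    simp
    ring
  apply mul_left_cancel₀ (factorial_mul_ne_zero k (l + 1))
  rw [ContinuousAlternatingMap.smul_apply, smul_eq_mul, mul_left_comm, h2, ← mul_assoc, ← pow_add,
    Even.neg_one_pow ⟨k, rfl⟩, one_mul, ← h1, Nat.factorial_succ]
  push_cast
  ring

/-- Same count as in `alternatize_wedge_right`, but the differentiating vector sits in slot `j` of
the first factor, so the signs `(-1)^j` cancel and no `(-1)^k` remains. -/
theorem alternatize_wedge_left {k l m : ℕ} (h : k + l = m) (h' : k + 1 + l = m + 1)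
    (c : V [⋀^Fin l]→L[ℝ] ℝ) (L : V →L[ℝ] V [⋀^Fin k]→L[ℝ] ℝ) :
    ContinuousAlternatingMap.alternatizeUncurryFin (((wedgeCLM h).flip c).comp L) =
      wedge h' (ContinuousAlternatingMap.alternatizeUncurryFin L) c := by
  ext v
  set F : (Fin (m + 1) → Fin (m + 1)) → ℝ := fun σ =>
    L (v (σ 0)) (fun i => v (σ (Fin.succ (Fin.cast h (Fin.castAdd l i))))) *
      c (fun i => v (σ (Fin.succ (Fin.cast h (Fin.natAdd k i))))) with hF
  set S : ℝ := ∑ σ : Equiv.Perm (Fin (m + 1)), ((Equiv.Perm.sign σ : ℤ) : ℝ) * F σ with hS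
  have h1 : ((k.factorial : ℝ) * l.factorial) *
      ContinuousAlternatingMap.alternatizeUncurryFin (((wedgeCLM h).flip c).comp L) v = S := by
    rw [alternatizeUncurryFin_apply', hS, sum_perm_succ, Finset.mul_sum]
    refine Finset.sum_congr rfl fun i _ => ?_
    rw [mul_left_comm, ContinuousLinearMap.comp_apply, ContinuousLinearMap.flip_apply,
      wedgeCLM_apply, wedge_apply]
    simp [hF]
  have h2 : (((k + 1).factorial : ℝ) * l.factorial) *
      wedge h' (ContinuousAlternatingMap.alternatizeUncurryFin L) c v = (k + 1) * S := by
    rw [wedge_apply]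
    simp only [alternatizeUncurryFin_apply', Finset.mul_sum, Finset.sum_mul]
    rw [Finset.sum_comm]
    have h3 : ∀ j : Fin (k + 1), ∑ σ : Equiv.Perm (Fin (m + 1)),
        ((Equiv.Perm.sign σ : ℤ) : ℝ) *
          ((-1) ^ (j : ℕ) * L (v (σ (Fin.cast h' (Fin.castAdd l j))))
              (fun i => v (σ (Fin.cast h' (Fin.castAdd l (j.succAbove i))))) *
            c (fun i => v (σ (Fin.cast h' (Fin.natAdd (k + 1) i))))) = S := by
      intro j
      have hl : ∀ i, Fin.cast h' (Fin.castAdd l (j.succAbove i)) =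
          (Fin.cast h' (Fin.castAdd l j)).succAbove (Fin.cast h (Fin.castAdd l i)) := by
        intro i
        ext
        simp only [Fin.succAbove, Fin.lt_def, Fin.val_cast, Fin.val_castAdd, Fin.val_castSucc]
        split_ifs <;> simp
      have hr : ∀ i, Fin.cast h' (Fin.natAdd (k + 1) i) =
          (Fin.cast h' (Fin.castAdd l j)).succAbove (Fin.cast h (Fin.natAdd k i)) := by
        intro i
        ext
        simp only [Fin.succAbove, Fin.lt_def, Fin.val_cast, Fin.val_castAdd, Fin.val_natAdd,
          Fin.val_castSucc]
        split_ifs <;> simp <;> omega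
      have h4 := sum_perm_succAbove (Fin.cast h' (Fin.castAdd l j)) F
      rw [← hS, Fin.val_cast, Fin.val_castAdd] at h4
      have h5 : (-1 : ℝ) ^ (j : ℕ) * (-1) ^ (j : ℕ) = 1 := by
        rw [← mul_pow]; simp
      rw [show S = (-1) ^ (j : ℕ) * ((-1) ^ (j : ℕ) * S) by
        linear_combination (-S) * h5, ← h4, Finset.mul_sum]
      refine Finset.sum_congr rfl fun σ _ => ?_
      simp only [hF, Fin.cons_zero, Fin.cons_succ, hl, hr]
      ring
    rw [Finset.sum_congr rfl fun j _ => h3 j]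
    simp
  apply mul_left_cancel₀ (factorial_mul_ne_zero (k + 1) l)
  rw [h2, ← h1, Nat.factorial_succ]
  push_cast
  ring

end Alternatization

/-! ### Exterior calculus on a normed space -/

section Calculus

variable {E : Type*} [NormedAddCommGroup E] [NormedSpace ℝ E]

theorem minSmoothness_two_le : minSmoothness ℝ 2 ≤ ∞ := by
  rw [minSmoothness_of_isRCLikeNormedField]
  exact WithTop.coe_le_coe.2 le_top

/-- The product rule for the bilinear map `wedgeCLM` gives two summands, each alternatized
separately. -/
theorem extDeriv_wedge {k l m : ℕ} (h : k + l = m) (hl : k + 1 + l = m + 1)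
    (hr : k + (l + 1) = m + 1) {b : E → E [⋀^Fin k]→L[ℝ] ℝ} {a : E → E [⋀^Fin l]→L[ℝ] ℝ} {x : E}
    (hb : DifferentiableAt ℝ b x) (ha : DifferentiableAt ℝ a x) :
    extDeriv (fun y => wedge h (b y) (a y)) x =
      wedge hl (extDeriv b x) (a x) + (-1 : ℝ) ^ k • wedge hr (b x) (extDeriv a x) := by
  have hd : fderiv ℝ (fun y => wedge h (b y) (a y)) x =
      ((wedgeCLM h).flip (a x)).comp (fderiv ℝ b x) + (wedgeCLM h (b x)).comp (fderiv ℝ a x) := by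
    refine ((wedgeCLM h).hasFDerivAt_of_bilinear hb.hasFDerivAt ha.hasFDerivAt).fderiv.trans ?_
    rw [add_comm]
    rfl
  rw [extDeriv, hd, ContinuousAlternatingMap.alternatizeUncurryFin_add,
    alternatize_wedge_left h hl, alternatize_wedge_right h hr]
  rfl

theorem ContDiffAt.wedge {k l m : ℕ} (h : k + l = m) {b : E → E [⋀^Fin k]→L[ℝ] ℝ}
    {a : E → E [⋀^Fin l]→L[ℝ] ℝ} {x : E} (hb : ContDiffAt ℝ ∞ b x) (ha : ContDiffAt ℝ ∞ a x) :
    ContDiffAt ℝ ∞ (fun y => wedge h (b y) (a y)) x := by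
  have hw : ContDiff ℝ ∞ (fun c : E [⋀^Fin k]→L[ℝ] ℝ => wedgeCLM (l := l) h c) :=
    ContinuousLinearMap.contDiff (𝕜 := ℝ) (E := E [⋀^Fin k]→L[ℝ] ℝ)
      (F := (E [⋀^Fin l]→L[ℝ] ℝ) →L[ℝ] E [⋀^Fin m]→L[ℝ] ℝ) _
  exact (hw.contDiffAt.comp x hb).clm_apply ha

theorem ContDiffAt.wedgePow {β : E → E [⋀^Fin 2]→L[ℝ] ℝ} {x : E} (hβ : ContDiffAt ℝ ∞ β x)
    (m : ℕ) : ContDiffAt ℝ ∞ (fun y => wedgePow (β y) m) x := by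
  induction m with
  | zero => exact contDiffAt_const
  | succ m ih => exact ContDiffAt.wedge _ ih hβ

theorem ContDiffAt.extDeriv {k : ℕ} {a : E → E [⋀^Fin k]→L[ℝ] ℝ} {x : E}
    (ha : ContDiffAt ℝ ∞ a x) : ContDiffAt ℝ ∞ (extDeriv a) x := by
  have hA : ContDiff ℝ ∞ (fun L : E →L[ℝ] E [⋀^Fin k]→L[ℝ] ℝ =>
      ContinuousAlternatingMap.alternatizeUncurryFinCLM ℝ E ℝ L) :=
    ContinuousLinearMap.contDiff (𝕜 := ℝ) (E := E →L[ℝ] E [⋀^Fin k]→L[ℝ] ℝ)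
      (F := E [⋀^Fin (k + 1)]→L[ℝ] ℝ) _
  exact hA.contDiffAt.comp x (ha.fderiv_right (m := ∞) (by simp))

theorem extDeriv_wedgePow_extDeriv {a : E → E [⋀^Fin 1]→L[ℝ] ℝ} {x : E}
    (ha : ContDiffAt ℝ ∞ a x) (m : ℕ) :
    extDeriv (fun y => wedgePow (extDeriv a y) m) x = 0 := by
  induction m with
  | zero =>
    have h := extDeriv_constOfIsEmpty (𝕜 := ℝ) (E := E) (fun _ => (1 : ℝ)) x
    refine h.trans ?_
    ext v
    simp
  | succ m ih =>
    have h := extDeriv_wedge (rfl : 2 * m + 2 = 2 * (m + 1)) (by omega) (by omega)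
      ((ContDiffAt.wedgePow (ContDiffAt.extDeriv ha) m).differentiableAt (by simp))
      ((ContDiffAt.extDeriv ha).differentiableAt (by simp))
    refine h.trans ?_
    rw [ih, extDeriv_extDeriv_apply ha minSmoothness_two_le, wedge_zero_left, wedge_zero_right]
    simp

/-- The form `(da)^(m + 1)` is the exterior derivative of `(da)^m ∧ a`. -/
theorem extDeriv_wedgePow_wedge {a : E → E [⋀^Fin 1]→L[ℝ] ℝ} {x : E}
    (ha : ContDiffAt ℝ ∞ a x) (m : ℕ) :
    extDeriv (fun y => wedge (rfl : 2 * m + 1 = 2 * m + 1) (wedgePow (extDeriv a y) m) (a y)) x =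
      wedgePow (extDeriv a x) (m + 1) := by
  rw [extDeriv_wedge rfl (by omega) rfl
    ((ContDiffAt.wedgePow (ContDiffAt.extDeriv ha) m).differentiableAt (by simp))
    (ha.differentiableAt (by simp)), extDeriv_wedgePow_extDeriv ha, wedge_zero_left, zero_add,
    (even_two_mul m).neg_one_pow, one_smul]
  -- With `a` as the last factor, the surviving term `(da)^m ∧ da` is the recursive clause of
  -- `wedgePow`.
  rfl

theorem extDeriv_one_form_apply {a : E → E [⋀^Fin 1]→L[ℝ] ℝ} {x : E} (v w : E) :
    extDeriv a x ![v, w] =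
      fderiv ℝ a x v (fun _ => w) - fderiv ℝ a x w (fun _ => v) := by
  rw [extDeriv, alternatizeUncurryFin_apply', Fin.sum_univ_two]
  have h0 : (fun j : Fin 1 => (![v, w] : Fin 2 → E) ((0 : Fin 2).succAbove j)) = fun _ => w := by
    funext j; fin_cases j; rfl
  have h1 : (fun j : Fin 1 => (![v, w] : Fin 2 → E) ((1 : Fin 2).succAbove j)) = fun _ => v := by
    funext j; fin_cases j; rfl
  rw [h0, h1]
  simp
  ring

/-- Cartan's formula for a `1`-form `a` and a vector field `V` with `a(V)` constant: the
interior product `ι(V) da` is the Lie derivative of `a` along `V`. -/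
theorem extDeriv_apply_of_pairing_const {a : E → E [⋀^Fin 1]→L[ℝ] ℝ} {V : E → E} {x : E} {c : ℝ}
    (ha : DifferentiableAt ℝ a x) (hV : DifferentiableAt ℝ V x)
    (h : ∀ᶠ y in 𝓝 x, a y (fun _ => V y) = c) (w : E) :
    extDeriv a x ![V x, w] =
      fderiv ℝ a x (V x) (fun _ => w) + a x (fun _ => fderiv ℝ V x w) := by
  let B : (E [⋀^Fin 1]→L[ℝ] ℝ) →L[ℝ] E →L[ℝ] ℝ :=
    (ContinuousAlternatingMap.ofSubsingletonLIE (𝕜 := ℝ) (E := E) (F := ℝ)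
      (0 : Fin 1)).symm.toContinuousLinearEquiv
  have hB : ∀ (b : E [⋀^Fin 1]→L[ℝ] ℝ) v, B b v = b (fun _ => v) := fun b v => rfl
  have hd := B.hasFDerivAt_of_bilinear ha.hasFDerivAt hV.hasFDerivAt
  have hc : HasFDerivAt (fun y => B (a y) (V y)) (0 : E →L[ℝ] ℝ) x :=
    (hasFDerivAt_const c x).congr_of_eventuallyEq h
  -- Differentiating the constant pairing along `w` trades `-(∂_w a)(V)` for `a(∂_w V)`.
  have he : B (a x) (fderiv ℝ V x w) + B (fderiv ℝ a x w) (V x) = 0 :=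
    DFunLike.congr_fun (hd.unique hc) w
  rw [hB, hB] at he
  rw [extDeriv_one_form_apply]
  linarith

end Calculus

/-! ### Chart independence of the exterior derivative -/

section Manifold

variable {d : ℕ} {M : Type*} [TopologicalSpace M] [ChartedSpace (Model d) M]
  [IsManifold (𝓡 d) ∞ M]

/-- In every chart, the exterior derivative is the exterior derivative of the coordinate
expression. -/
theorem inChart_extD {k : ℕ} {β : FormField d M k} (hβ : IsSmoothForm β) (x₀ : M) {y : Model d}
    (hy : y ∈ (extChartAt (𝓡 d) x₀).target) :
    inChart (extD β) x₀ y = extDeriv (inChart β x₀) y := by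
  set x := (extChartAt (𝓡 d) x₀).symm y with hx
  -- At `x`, `extD` uses the chart at `x` rather than the one at `x₀`. Near `y` the expression of
  -- `β` in the chart at `x₀` is the pullback under the transition map `τ` of its expression in the
  -- chart at `x`, and `extDeriv` commutes with pullback.
  set τ : Model d → Model d := extChartAt (𝓡 d) x ∘ (extChartAt (𝓡 d) x₀).symm with hτ
  have hs : ∀ z ∈ (extChartAt (𝓡 d) x₀).target,
      ContMDiffAt 𝓘(ℝ, Model d) (𝓡 d) ∞ (extChartAt (𝓡 d) x₀).symm z := fun z hz =>
    (contMDiffOn_extChartAt_symm x₀).contMDiffAt ((isOpen_extChartAt_target x₀).mem_nhds hz)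
  have hτs : ContDiffAt ℝ ∞ τ y :=
    ((contMDiffAt_extChartAt (x := x)).comp y (hs y hy)).contDiffAt
  have hev : ∀ᶠ z in 𝓝 y, z ∈ (extChartAt (𝓡 d) x₀).target ∧
      (extChartAt (𝓡 d) x₀).symm z ∈ (extChartAt (𝓡 d) x).source :=
    ((isOpen_extChartAt_target x₀).mem_nhds hy |> Filter.eventually_of_mem <| fun _ h => h).and
      ((hs y hy).continuousAt.eventually (extChartAt_source_mem_nhds x))
  have hloc : inChart β x₀ =ᶠ[𝓝 y]
      fun z => (inChart β x (τ z)).compContinuousLinearMap (fderiv ℝ τ z) := by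
    -- The factorization through `τ` must hold on a neighbourhood of `z`, since it is differentiated
    -- there.
    filter_upwards [hev.eventually_nhds] with z hz
    obtain ⟨hzt, hzs⟩ := hz.self_of_nhds
    have hφ : ContMDiffAt (𝓡 d) 𝓘(ℝ, Model d) ∞ (extChartAt (𝓡 d) x)
        ((extChartAt (𝓡 d) x₀).symm z) :=
      contMDiffAt_extChartAt' (by rwa [extChartAt_source] at hzs)
    have hτz : MDifferentiableAt 𝓘(ℝ, Model d) 𝓘(ℝ, Model d) τ z :=
      (hφ.comp z (hs z hzt)).mdifferentiableAt (by simp)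
    have hφs : MDifferentiableAt 𝓘(ℝ, Model d) (𝓡 d) (extChartAt (𝓡 d) x).symm (τ z) :=
      ((contMDiffOn_extChartAt_symm (n := ∞) x).contMDiffAt
        ((isOpen_extChartAt_target x).mem_nhds
          ((extChartAt (𝓡 d) x).map_source hzs))).mdifferentiableAt (by simp)
    have hcomp : (extChartAt (𝓡 d) x₀).symm =ᶠ[𝓝 z] (extChartAt (𝓡 d) x).symm ∘ τ := by
      filter_upwards [hz] with u hu
      exact ((extChartAt (𝓡 d) x).left_inv hu.2).symm
    obtain ⟨D, hD⟩ : ∃ D : Model d →L[ℝ] Model d, D = fderiv ℝ τ z := ⟨_, rfl⟩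
    have hDm : mfderiv 𝓘(ℝ, Model d) 𝓘(ℝ, Model d) τ z = D := by
      rw [hD]; exact mfderiv_eq_fderiv
    have hm : (mfderiv 𝓘(ℝ, Model d) (𝓡 d) (extChartAt (𝓡 d) x₀).symm z :
        Model d →L[ℝ] Model d) =
        (mfderiv 𝓘(ℝ, Model d) (𝓡 d) (extChartAt (𝓡 d) x).symm (τ z) :
          Model d →L[ℝ] Model d).comp D := by
      rw [← hDm]
      exact hcomp.mfderiv_eq.trans (mfderiv_comp z hφs hτz)
    have hpt : (extChartAt (𝓡 d) x).symm (τ z) = (extChartAt (𝓡 d) x₀).symm z :=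
      (extChartAt (𝓡 d) x).left_inv hzs
    simp only [inChart]
    rw [hm, hpt, ← hD]
    rfl
  have hpb := extDeriv_pullback (f := τ) (x := y) (hβ.differentiableAt x) hτs
    minSmoothness_two_le
  rw [hloc.extDeriv_eq, hpb]
  have hfd : fderiv ℝ τ y =
      (mfderiv (𝓡 d) 𝓘(ℝ, Model d) (extChartAt (𝓡 d) x) x : Model d →L[ℝ] Model d).comp
        (mfderiv 𝓘(ℝ, Model d) (𝓡 d) (extChartAt (𝓡 d) x₀).symm y : Model d →L[ℝ] Model d) := by
    rw [← mfderiv_eq_fderiv]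
    exact mfderiv_comp y ((contMDiffAt_extChartAt (n := ∞) (x := x)).mdifferentiableAt (by simp))
      ((hs y hy).mdifferentiableAt (by simp))
  rw [hfd]
  rfl

end Manifold

/-! ### Powers of `dα` and the Reeb field -/

section Reeb

variable {d : ℕ} {M : Type*} [TopologicalSpace M] [ChartedSpace (Model d) M]

theorem IsSmoothForm.contDiffAt {k : ℕ} {β : FormField d M k} (hβ : IsSmoothForm β) (x₀ : M)
    {y : Model d} (hy : y ∈ (extChartAt (𝓡 d) x₀).target) : ContDiffAt ℝ ∞ (inChart β x₀) y :=
  (hβ x₀).contDiffAt ((isOpen_extChartAt_target x₀).mem_nhds hy)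

/-- The form `(dα)^m` for a `1`-form `α`. -/
def extDPow (α : FormField d M 1) (m : ℕ) : FormField d M (2 * m) :=
  fun x => wedgePow (extD α x) m

/-- The primitive `(dα)^m ∧ α` of `(dα)^(m + 1)`. -/
def extDPowWedge (α : FormField d M 1) (m : ℕ) : FormField d M (2 * m + 1) :=
  fun x => wedge (rfl : 2 * m + 1 = 2 * m + 1) (wedgePow (extD α x) m) (α x)

variable [IsManifold (𝓡 d) ∞ M]

theorem inChart_extDPow {α : FormField d M 1} (hα : IsSmoothForm α) (m : ℕ) (x₀ : M)
    {y : Model d} (hy : y ∈ (extChartAt (𝓡 d) x₀).target) :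
    inChart (extDPow α m) x₀ y = wedgePow (extDeriv (inChart α x₀) y) m := by
  rw [← inChart_extD hα x₀ hy]
  exact wedgePow_compContinuousLinearMap _ _ _

theorem inChart_extDPowWedge {α : FormField d M 1} (hα : IsSmoothForm α) (m : ℕ) (x₀ : M)
    {y : Model d} (hy : y ∈ (extChartAt (𝓡 d) x₀).target) :
    inChart (extDPowWedge α m) x₀ y =
      wedge (rfl : 2 * m + 1 = 2 * m + 1) (wedgePow (extDeriv (inChart α x₀) y) m)
        (inChart α x₀ y) := by
  rw [← inChart_extDPow hα m x₀ hy]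
  exact wedge_compContinuousLinearMap _ _ _ _

theorem isSmoothForm_extDPow {α : FormField d M 1} (hα : IsSmoothForm α) (m : ℕ) :
    IsSmoothForm (extDPow α m) := fun x₀ =>
  ContDiffOn.congr (fun _ hy => (ContDiffAt.wedgePow
    (ContDiffAt.extDeriv (hα.contDiffAt x₀ hy)) m).contDiffWithinAt)
    fun _ hy => inChart_extDPow hα m x₀ hy

theorem isSmoothForm_extDPowWedge {α : FormField d M 1} (hα : IsSmoothForm α) (m : ℕ) :
    IsSmoothForm (extDPowWedge α m) := fun x₀ =>
  ContDiffOn.congr (fun _ hy => (ContDiffAt.wedge rfl (ContDiffAt.wedgePow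
    (ContDiffAt.extDeriv (hα.contDiffAt x₀ hy)) m) (hα.contDiffAt x₀ hy)).contDiffWithinAt)
    fun _ hy => inChart_extDPowWedge hα m x₀ hy

theorem extDPow_mem_closedForms {α : FormField d M 1} (hα : IsSmoothForm α) (m : ℕ) :
    extDPow α m ∈ closedForms d M (2 * m) := by
  refine ⟨isSmoothForm_extDPow hα m, ?_⟩
  funext x
  have h : inChart (extDPow α m) x =ᶠ[𝓝 (extChartAt (𝓡 d) x x)]
      fun y => wedgePow (extDeriv (inChart α x) y) m := by
    filter_upwards [extChartAt_target_mem_nhds (I := 𝓡 d) x] with y hy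
    exact inChart_extDPow hα m x hy
  rw [extD, h.extDeriv_eq,
    extDeriv_wedgePow_extDeriv (hα.contDiffAt x (mem_extChartAt_target x))]
  rfl

theorem mfderiv_extChartAt_comp_symm (x : M) :
    (mfderiv (𝓡 d) 𝓘(ℝ, Model d) (extChartAt (𝓡 d) x) x : Model d →L[ℝ] Model d).comp
      (mfderiv 𝓘(ℝ, Model d) (𝓡 d) (extChartAt (𝓡 d) x).symm (extChartAt (𝓡 d) x x) :
        Model d →L[ℝ] Model d) = ContinuousLinearMap.id ℝ (Model d) := by
  have h := mfderiv_extChartAt_comp_mfderivWithin_extChartAt_symm' (I := 𝓡 d) (x := x)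
    (mem_extChartAt_source x)
  rw [ModelWithCorners.range_eq_univ, mfderivWithin_univ] at h
  exact h

theorem extD_extDPowWedge {α : FormField d M 1} (hα : IsSmoothForm α) (m : ℕ) :
    extD (extDPowWedge α m) = extDPow α (m + 1) := by
  funext x
  have h : inChart (extDPowWedge α m) x =ᶠ[𝓝 (extChartAt (𝓡 d) x x)]
      fun y => wedge (rfl : 2 * m + 1 = 2 * m + 1) (wedgePow (extDeriv (inChart α x) y) m)
        (inChart α x y) := by
    filter_upwards [extChartAt_target_mem_nhds (I := 𝓡 d) x] with y hy
    exact inChart_extDPowWedge hα m x hy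
  rw [extD, h.extDeriv_eq,
    extDeriv_wedgePow_wedge (hα.contDiffAt x (mem_extChartAt_target x))]
  exact wedgePow_compContinuousLinearMap _ _ _

/-- The coordinate expression of a vector field in the preferred chart at `x`. -/
def fieldInChart (R : VecField d M) (x : M) : Model d → Model d :=
  VectorField.mpullback 𝓘(ℝ, Model d) (𝓡 d) (extChartAt (𝓡 d) x).symm R

theorem isInvertible_mfderiv_extChartAt_symm (x : M) {y : Model d}
    (hy : y ∈ (extChartAt (𝓡 d) x).target) :
    (mfderiv 𝓘(ℝ, Model d) (𝓡 d) (extChartAt (𝓡 d) x).symm y).IsInvertible := by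
  have h := isInvertible_mfderivWithin_extChartAt_symm (I := 𝓡 d) (x := x) hy
  rwa [ModelWithCorners.range_eq_univ, mfderivWithin_univ] at h

theorem mfderiv_fieldInChart (R : VecField d M) (x : M) {y : Model d}
    (hy : y ∈ (extChartAt (𝓡 d) x).target) :
    (mfderiv 𝓘(ℝ, Model d) (𝓡 d) (extChartAt (𝓡 d) x).symm y : Model d →L[ℝ] Model d)
      (fieldInChart R x y) = R ((extChartAt (𝓡 d) x).symm y) :=
  (isInvertible_mfderiv_extChartAt_symm x hy).self_apply_inverse _

theorem IsSmoothField.differentiableAt_fieldInChart {R : VecField d M} (hR : IsSmoothField R)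
    (x : M) : DifferentiableAt ℝ (fieldInChart R x) (extChartAt (𝓡 d) x x) := by
  have hs : ContMDiffAt 𝓘(ℝ, Model d) (𝓡 d) ∞ (extChartAt (𝓡 d) x).symm
      (extChartAt (𝓡 d) x x) :=
    (contMDiffOn_extChartAt_symm x).contMDiffAt (extChartAt_target_mem_nhds x)
  have h := ContMDiffAt.mpullback_vectorField_preimage (m := 1)
    ((hR _).of_le (by simp)) hs
    (isInvertible_mfderiv_extChartAt_symm x (mem_extChartAt_target x))
    (by rw [one_add_one_eq_two]; exact WithTop.coe_le_coe.2 le_top)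
  exact (contMDiffAt_vectorSpace_iff_contDiffAt.1 h).differentiableAt (by simp)

/-- If `L_R α = 0` and `α(R) = 1`, then `ι(R) dα = 0`. -/
theorem annihilates_extD {α : FormField d M 1} (hα : IsSmoothForm α) {R : VecField d M}
    (hR : IsSmoothField R) (hL : lieD R α = 0) (h1 : ∀ x, α x (fun _ => R x) = 1) (x : M) :
    Annihilates (R x : Model d) (extD α x) := by
  obtain ⟨D, hD⟩ : ∃ D : Model d →L[ℝ] Model d,
    D = mfderiv (𝓡 d) 𝓘(ℝ, Model d) (extChartAt (𝓡 d) x) x := ⟨_, rfl⟩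
  have hDR : D (R x) = fieldInChart R x (extChartAt (𝓡 d) x x) := by
    have h2 := mfderiv_fieldInChart R x (mem_extChartAt_target x)
    have h3 := DFunLike.congr_fun (mfderiv_extChartAt_comp_symm x)
      (fieldInChart R x (extChartAt (𝓡 d) x x))
    have h4 : ∀ z, z = x → (R z : Model d) = R x := fun z hz => by rw [hz]
    rw [← hD] at h3
    refine Eq.trans ?_ h3
    refine congrArg D ?_
    exact (h4 _ (extChartAt_to_inv x)).symm.trans h2.symm
  apply annihilates_two
  intro w
  -- The form is pulled back and the field pushed by mutually inverse derivatives, so the coordinate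
  -- pairing is still `α(R) = 1`.
  have hpair : ∀ᶠ y in 𝓝 (extChartAt (𝓡 d) x x),
      inChart α x y (fun _ => fieldInChart R x y) = 1 := by
    filter_upwards [extChartAt_target_mem_nhds (I := 𝓡 d) x] with y hy
    refine Eq.trans ?_ (h1 ((extChartAt (𝓡 d) x).symm y))
    exact congrArg (α ((extChartAt (𝓡 d) x).symm y)) (funext fun _ => mfderiv_fieldInChart R x hy)
  have hc := extDeriv_apply_of_pairing_const (hα.differentiableAt x)
    (hR.differentiableAt_fieldInChart x) hpair (D w)
  -- Read in the chart at `x`, the vanishing of `L_R α` on `w` is the vanishing of the right side of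
  -- Cartan's formula at `D w`.
  have hl : lieD R α x (fun _ => w) = 0 := by rw [hL]; rfl
  have hl' : fderiv ℝ (inChart α x) (extChartAt (𝓡 d) x x)
      (fieldInChart R x (extChartAt (𝓡 d) x x)) (fun _ => D w) +
      inChart α x (extChartAt (𝓡 d) x x)
        (fun _ => fderiv ℝ (fieldInChart R x) (extChartAt (𝓡 d) x x) (D w)) = 0 := by
    rw [hD]; exact hl
  rw [hl', ← hDR] at hc
  refine Eq.trans ?_ hc
  have hv : (![D (R x), D w] : Fin 2 → Model d) = D ∘ ![(R x : Model d), w] := by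
    funext i; fin_cases i <;> rfl
  rw [hv, hD]
  rfl

end Reeb

/-! ### The flux of the Reeb field -/

theorem interiorProd_contactVolume {n : ℕ} {M : Type*} [TopologicalSpace M]
    [ChartedSpace (Model (2 * n + 1)) M] [IsManifold (𝓡 (2 * n + 1)) ∞ M]
    {α : FormField (2 * n + 1) M 1} (hα : IsSmoothForm α) {R : VecField (2 * n + 1) M}
    (hR : IsReebField α R) :
    (fun x => interiorProd (R x : Model (2 * n + 1)) (contactVolume α x)) = extDPow α n := by
  funext x
  exact interiorProd_wedge _ (hR.2.2 x) ((annihilates_extD hα hR.1 hR.2.1 hR.2.2 x).wedgePow n)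

theorem hasFlux_reeb {n : ℕ} (hn : 1 ≤ n) {M : Type*} [TopologicalSpace M]
    [ChartedSpace (Model (2 * n + 1)) M] [IsManifold (𝓡 (2 * n + 1)) ∞ M]
    {α : FormField (2 * n + 1) M 1} (hα : IsSmoothForm α) {R : VecField (2 * n + 1) M}
    (hR : IsReebField α R) : HasFlux (contactVolume α) (fun _ : ℝ => R) 0 := by
  have hι := interiorProd_contactVolume hα hR
  have hflux : fluxForm (contactVolume α) (fun _ : ℝ => R) = extDPow α n := by
    rw [← hι]
    funext x
    rw [fluxForm, intervalIntegral.integral_const, sub_zero, one_smul]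
    rfl
  have hcl := extDPow_mem_closedForms hα n
  refine ⟨?_, fun t _ => ?_, ?_⟩
  · exact (hR.1.comp contMDiff_snd).contMDiffOn
  · have h : (fun x => interiorProd (R x : Model (2 * n + 1)) (contactVolume α x) :
        FormField (2 * n + 1) M (2 * n)) ∈ closedForms (2 * n + 1) M (2 * n) := hι.symm ▸ hcl
    exact h
  · rw [hflux]
    refine ⟨hcl, ?_⟩
    rw [deRhamClass, Submodule.Quotient.mk_eq_zero, Submodule.mem_comap]
    have hex : ∀ m, extDPow α (m + 1) ∈ exactForms (2 * n + 1) M (2 * (m + 1)) := fun m =>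
      ⟨extDPowWedge α m, isSmoothForm_extDPowWedge hα m, extD_extDPowWedge hα m⟩
    -- For `n = 0` the form is the constant `1`, which is not exact; a positive `n` leaves one
    -- factor `dα` to integrate.
    obtain ⟨m, hm⟩ := Nat.exists_eq_add_of_le' hn
    -- The exponent is separated from `n`, which also fixes the dimension of `M`, so that `m + 1`
    -- can be substituted for it alone.
    have hex' : ∀ k, k = m + 1 → extDPow α k ∈ exactForms (2 * n + 1) M (2 * k) := by
      rintro _ rfl
      exact hex m
    exact hex' n hm

end VolumeFlux

end

theorem corollary3p2 (n : ℕ) (hn : 1 ≤ n)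
    (M : Type*) [TopologicalSpace M] [T2Space M] [CompactSpace M] [ConnectedSpace M]
    [ChartedSpace (VolumeFlux.Model (2 * n + 1)) M] [IsManifold (𝓡 (2 * n + 1)) ∞ M]
    (α : VolumeFlux.FormField (2 * n + 1) M 1) (hα : VolumeFlux.IsContactForm α)
    (R : VolumeFlux.VecField (2 * n + 1) M) (hR : VolumeFlux.IsReebField α R) :
    VolumeFlux.HasFlux (VolumeFlux.contactVolume α) (fun _ : ℝ => R) 0 ∧
      ∀ φ : VolumeFlux.Isotopy (2 * n + 1) M, φ.IsGeneratedBy (fun _ : ℝ => R) →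
        φ.HasFlux (VolumeFlux.contactVolume α) 0 :=
  have h := VolumeFlux.hasFlux_reeb hn hα.1 hR
  ⟨h, fun _ hφ => ⟨_, hφ, h⟩⟩
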